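/- Let $\Sigma$ be a smooth two-dimensional manifold without boundary, with a smooth Riemannian metric $\mathbf g$ and an orientation. Let $\star_{\mathbf g}1$ be the area form, let $\nabla^{\mathbf g}$ be the Levi-Civita connection, with curvature $R(X,Y)Z=\nabla^{\mathbf g}_X\nabla^{\mathbf g}_YZ-\nabla^{\mathbf g}_Y\nabla^{\mathbf g}_XZ-\nabla^{\mathbf g}_{[X,Y]}Z$, let $\boldsymbol j_{\mathbf g}$ be the endomorphism of $T\Sigma$ determined by $\mathbf g(\boldsymbol j_{\mathbf g}X,Y)=\star_{\mathbf g}1(X,Y)$, and let $\langle\cdot,\cdot\rangle=\mathbf g+\sqrt{-1}\,\star_{\mathbf g}1$. With $\sqrt{-1}\cdot Y:=\boldsymbol j_{\mathbf g}(Y)$, $(T\Sigma,\boldsymbol j_{\mathbf g},\langle\cdot,\cdot\rangle)$ is a smooth Hermitian complex line bundle (complex linear in the second variable), and $\nabla^{\mathbf g}$ is a Hermitian connection on it: it commutes with $\boldsymbol j_{\mathbf g}$ and is compatible with $\langle\cdot,\cdot\rangle$. Consequently there is a complex-valued $2$-form $curv(\nabla^{\mathbf g})$ with $R(X,Y)Z=curv(\nabla^{\mathbf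 g})(X,Y)\cdot Z$ for all smooth vector fields $X,Y,Z$. Let $$K_{\mathbf g}(p)=\frac{\mathbf g(R(u,v)v,u)}{\mathbf g(u,u)\,\mathbf g(v,v)-\mathbf g(u,v)^2},\qquad u,v\text{ any basis of }T_p\Sigma,$$ be the sectional curvature; it does not depend on the basis and is a smooth function on $\Sigma$. Then $$\sqrt{-1}\cdot curv(\nabla^{\mathbf g})=K_{\mathbf g}\,\star_{\mathbf g}1 .$$ -/

import Mathlib

open Bundle Manifold VectorField FiberBundle
open scoped ContDiff Topology

noncomputable section LeviCivita

variable {E : Type*} [NormedAddCommGroup E] [NormedSpace ℝ E] [FiniteDimensional ℝ E]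
  {H : Type*} [TopologicalSpace H] (I : ModelWithCorners ℝ E H)
  {M : Type*} [TopologicalSpace M] [ChartedSpace H M] [IsManifold I ∞ M]
  [RiemannianBundle (fun x : M ↦ TangentSpace I x)]
  [IsContMDiffRiemannianBundle I ∞ E (fun x : M ↦ TangentSpace I x)]

/-- Right-hand side of the Koszul formula for `2 g(∇_X Y, Z)`. -/
def koszulAux (X Y Z : Π x : M, TangentSpace I x) (x : M) : ℝ :=
  d% (fun y ↦ inner ℝ (Y y) (Z y)) x (X x) + d% (fun y ↦ inner ℝ (X y) (Z y)) x (Y x)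
    - d% (fun y ↦ inner ℝ (X y) (Y y)) x (Z x)
    + inner ℝ (mlieBracket I X Y x) (Z x) - inner ℝ (mlieBracket I X Z x) (Y x)
    - inner ℝ (mlieBracket I Y Z x) (X x)

set_option linter.unusedSectionVars false

theorem mdifferentiableAt_inner {x : M} {X Y : Π x : M, TangentSpace I x}
    (hX : MDiffAt (T% X) x) (hY : MDiffAt (T% Y) x) :
    MDiffAt (fun y ↦ inner ℝ (X y) (Y y)) x :=
  MDifferentiableAt.inner_bundle (F := E) (E := fun x : M ↦ TangentSpace I x)
    (b := fun y ↦ y) hX hY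

theorem koszulAux_tensorial_left {x : M} {Y Z : Π x : M, TangentSpace I x}
    (hY : MDiffAt (T% Y) x) (hZ : MDiffAt (T% Z) x) :
    TensorialAt I E (fun X ↦ koszulAux I X Y Z x) x where
  smul {f X} hf hX := by
    have h1 := mvfderiv_fun_mul hf (mdifferentiableAt_inner I hX hZ)
    have h2 := mvfderiv_fun_mul hf (mdifferentiableAt_inner I hX hY)
    simp [koszulAux, inner_smul_left, inner_smul_right, h1, h2, mlieBracket_smul_left hf hX,
      inner_add_left]
    ring
  add {X X'} hX hX' := by
    have h1 := mvfderiv_fun_add (mdifferentiableAt_inner I hX hZ) (mdifferentiableAt_inner I hX' hZ)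
    have h2 := mvfderiv_fun_add (mdifferentiableAt_inner I hX hY) (mdifferentiableAt_inner I hX' hY)
    simp [koszulAux, inner_add_right, h1, h2, mlieBracket_add_left hX hX', inner_add_left]
    ring

theorem koszulAux_tensorial_right {x : M} {X Y : Π x : M, TangentSpace I x}
    (hX : MDiffAt (T% X) x) (hY : MDiffAt (T% Y) x) :
    TensorialAt I E (fun Z ↦ koszulAux I X Y Z x) x where
  smul {f Z} hf hZ := by
    have h1 := mvfderiv_fun_mul hf (mdifferentiableAt_inner I hX hZ)
    have h2 := mvfderiv_fun_mul hf (mdifferentiableAt_inner I hY hZ)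
    simp [koszulAux, inner_smul_left, inner_smul_right, h1, h2, mlieBracket_smul_right hf hZ,
      inner_add_left]
    rw [real_inner_comm (Y x) (Z x), real_inner_comm (X x) (Z x)]
    ring
  add {Z Z'} hZ hZ' := by
    have h1 := mvfderiv_fun_add (mdifferentiableAt_inner I hX hZ) (mdifferentiableAt_inner I hX hZ')
    have h2 := mvfderiv_fun_add (mdifferentiableAt_inner I hY hZ) (mdifferentiableAt_inner I hY hZ')
    simp [koszulAux, inner_add_right, h1, h2, mlieBracket_add_right hZ hZ', inner_add_left]
    ring

open scoped Classical in
/-- The Koszul form of the vector field `Y` at `x`: the bilinear form `2 g(∇_· Y, ·)` on `T_xM`.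
Only its value at vector fields differentiable at `x` matters. -/
def koszul (Y : Π x : M, TangentSpace I x) (x : M) :
    TangentSpace I x →L[ℝ] TangentSpace I x →L[ℝ] ℝ :=
  if hY : MDiffAt (T% Y) x then
    TensorialAt.mkHom₂ (fun X Z ↦ koszulAux I X Y Z x) x
      (fun _ hZ ↦ koszulAux_tensorial_left I hY hZ)
      (fun _ hX ↦ koszulAux_tensorial_right I hX hY)
  else 0

theorem koszul_apply {x : M} {X Y Z : Π x : M, TangentSpace I x}
    (hX : MDiffAt (T% X) x) (hY : MDiffAt (T% Y) x) (hZ : MDiffAt (T% Z) x) :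
    koszul I Y x (X x) (Z x) = koszulAux I X Y Z x := by
  rw [koszul, dif_pos hY]
  exact TensorialAt.mkHom₂_apply _ _ hX hZ

instance finiteDimensional_tangentSpace (x : M) : FiniteDimensional ℝ (TangentSpace I x) :=
  inferInstanceAs (FiniteDimensional ℝ E)

instance completeSpace_tangentSpace (x : M) : CompleteSpace (TangentSpace I x) :=
  FiniteDimensional.complete ℝ _

/-- The value at `x` of the Levi-Civita derivative `v ↦ ∇_v Y`. -/
def leviCivitaAux (Y : Π x : M, TangentSpace I x) (x : M) :
    TangentSpace I x →L[ℝ] TangentSpace I x :=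
  LinearMap.toContinuousLinearMap
    { toFun := fun v ↦ (2⁻¹ : ℝ) • (InnerProductSpace.toDual ℝ (TangentSpace I x)).symm
        (koszul I Y x v)
      map_add' := fun v w ↦ by simp
      map_smul' := fun c v ↦ by
        simp only [map_smul, RingHom.id_apply]
        exact smul_comm _ _ _ }

variable {I}

theorem inner_leviCivitaAux {x : M} {X Y Z : Π x : M, TangentSpace I x}
    (hX : MDiffAt (T% X) x) (hY : MDiffAt (T% Y) x) (hZ : MDiffAt (T% Z) x) :
    inner ℝ (leviCivitaAux I Y x (X x)) (Z x) = koszulAux I X Y Z x / 2 := by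
  rw [← koszul_apply I hX hY hZ]
  have : leviCivitaAux I Y x (X x) = (2⁻¹ : ℝ) •
    (InnerProductSpace.toDual ℝ (TangentSpace I x)).symm (koszul I Y x (X x)) := rfl
  rw [this, real_inner_smul_left, InnerProductSpace.toDual_symm_apply]
  ring

theorem tangent_ext_inner {x : M} {a b : TangentSpace I x}
    (h : ∀ Z : Π x : M, TangentSpace I x, MDiffAt (T% Z) x →
      inner ℝ a (Z x) = inner ℝ b (Z x)) : a = b := by
  refine ext_inner_right ℝ fun w ↦ ?_
  simpa using h (extend E w) (mdifferentiableAt_extend ..)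

theorem tangent_hom_ext {x : M} {A B : TangentSpace I x →L[ℝ] TangentSpace I x}
    (h : ∀ X : Π x : M, TangentSpace I x, MDiffAt (T% X) x → A (X x) = B (X x)) : A = B := by
  ext v
  simpa using h (extend E v) (mdifferentiableAt_extend ..)

variable (I M) in
/-- The Levi-Civita connection of a Riemannian manifold, defined by the Koszul formula. -/
def leviCivita : CovariantDerivative I E (fun x : M ↦ TangentSpace I x) where
  toFun := leviCivitaAux I
  isCovariantDerivativeOnUniv :=
    { add := by
        intro Y Y' x hY hY' _
        refine tangent_hom_ext fun X hX ↦ tangent_ext_inner fun Z hZ ↦ ?_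
        have hs : MDiffAt (T% (Y + Y')) x := mdifferentiableAt_add_section hY hY'
        rw [inner_leviCivitaAux hX hs hZ, add_apply, inner_add_left,
          inner_leviCivitaAux hX hY hZ, inner_leviCivitaAux hX hY' hZ]
        have h1 := mvfderiv_fun_add (mdifferentiableAt_inner I hY hZ)
          (mdifferentiableAt_inner I hY' hZ)
        have h2 := mvfderiv_fun_add (mdifferentiableAt_inner I hX hY)
          (mdifferentiableAt_inner I hX hY')
        simp [koszulAux, inner_add_left, inner_add_right, h1, h2, mlieBracket_add_left hY hY',
          mlieBracket_add_right hY hY']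
        ring
      leibniz := by
        intro Y f x hY hf _
        refine tangent_hom_ext fun X hX ↦ tangent_ext_inner fun Z hZ ↦ ?_
        have hs : MDiffAt (T% (f • Y)) x := hf.smul_section hY
        rw [inner_leviCivitaAux hX hs hZ, add_apply, inner_add_left,
          smul_apply, ContinuousLinearMap.smulRight_apply,
          real_inner_smul_left, real_inner_smul_left, inner_leviCivitaAux hX hY hZ]
        have h1 := mvfderiv_fun_mul hf (mdifferentiableAt_inner I hY hZ)
        have h2 := mvfderiv_fun_mul hf (mdifferentiableAt_inner I hX hY)
        simp [koszulAux, inner_smul_left, inner_smul_right, inner_add_left, h1, h2,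
          mlieBracket_smul_left hf hY, mlieBracket_smul_right hf hY]
        rw [real_inner_comm (Y x) (X x)]
        ring }

theorem leviCivita_apply {x : M} {X Y Z : Π x : M, TangentSpace I x}
    (hX : MDiffAt (T% X) x) (hY : MDiffAt (T% Y) x) (hZ : MDiffAt (T% Z) x) :
    inner ℝ (leviCivita I M Y x (X x)) (Z x) = koszulAux I X Y Z x / 2 :=
  inner_leviCivitaAux hX hY hZ

variable (I M) in
theorem leviCivita_torsion : (leviCivita I M).torsion = 0 := by
  rw [CovariantDerivative.torsion_eq_zero_iff]
  intro X Y x hX hY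
  refine tangent_ext_inner fun Z hZ ↦ ?_
  rw [inner_sub_left, leviCivita_apply hX hY hZ, leviCivita_apply hY hX hZ]
  have h : (fun y ↦ inner ℝ (Y y) (X y)) = fun y ↦ inner ℝ (X y) (Y y) :=
    funext fun y ↦ real_inner_comm _ _
  simp [koszulAux, h, mlieBracket_swap_apply (V := Y) (W := X)]
  ring

theorem leviCivita_metric {x : M} {X Y Z : Π x : M, TangentSpace I x}
    (hX : MDiffAt (T% X) x) (hY : MDiffAt (T% Y) x) (hZ : MDiffAt (T% Z) x) :
    d% (fun y ↦ inner ℝ (Y y) (Z y)) x (X x) =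
      inner ℝ (leviCivita I M Y x (X x)) (Z x) + inner ℝ (Y x) (leviCivita I M Z x (X x)) := by
  have e : inner ℝ (Y x) (leviCivita I M Z x (X x)) =
    inner ℝ (leviCivita I M Z x (X x)) (Y x) := real_inner_comm _ _
  rw [e, leviCivita_apply hX hY hZ, leviCivita_apply hX hZ hY]
  have h : (fun y ↦ inner ℝ (Z y) (Y y)) = fun y ↦ inner ℝ (Y y) (Z y) :=
    funext fun y ↦ real_inner_comm _ _
  simp [koszulAux, h, mlieBracket_swap_apply (V := Z) (W := Y)]
  ring

end LeviCivita

noncomputable section Surface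

variable {M : Type*} [TopologicalSpace M] [ChartedSpace (EuclideanSpace ℝ (Fin 2)) M]
  [IsManifold (𝓡 2) ∞ M]

/-- A vector field as a section of the projection `TM → M`. -/
abbrev asSection (X : Π x : M, TangentSpace (𝓡 2) x) (x : M) : TangentBundle (𝓡 2) M := ⟨x, X x⟩

/-- The curvature `R(X, Y)Z = ∇_X ∇_Y Z - ∇_Y ∇_X Z - ∇_[X,Y] Z` of a connection on the tangent
bundle, evaluated on vector fields. -/
def curvature (cov : CovariantDerivative (𝓡 2) (EuclideanSpace ℝ (Fin 2))
      (fun x : M ↦ TangentSpace (𝓡 2) x))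
    (X Y Z : Π x : M, TangentSpace (𝓡 2) x) (x : M) : TangentSpace (𝓡 2) x :=
  cov (fun y ↦ cov Z y (Y y)) x (X x) - cov (fun y ↦ cov Z y (X y)) x (Y x)
    - cov Z x (mlieBracket (𝓡 2) X Y x)

/-- The curvature tensor on tangent vectors: `curvature` evaluated on the extensions of the vectors
to vector fields that are smooth near the base point (constant in the chosen trivialization). -/
def curvatureTensor (cov : CovariantDerivative (𝓡 2) (EuclideanSpace ℝ (Fin 2))
      (fun x : M ↦ TangentSpace (𝓡 2) x))
    (x : M) (u v w : TangentSpace (𝓡 2) x) : TangentSpace (𝓡 2) x :=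
  curvature cov (extend (EuclideanSpace ℝ (Fin 2)) u) (extend (EuclideanSpace ℝ (Fin 2)) v)
    (extend (EuclideanSpace ℝ (Fin 2)) w) x

/-- Multiplication of a tangent vector by a complex number, given the endomorphism `J` that plays
the role of `√-1`. -/
def complexSMul {x : M} (J : TangentSpace (𝓡 2) x →ₗ[ℝ] TangentSpace (𝓡 2) x) (c : ℂ)
    (v : TangentSpace (𝓡 2) x) : TangentSpace (𝓡 2) x :=
  c.re • v + c.im • J v

/-- `J` is a smooth complex structure on the real vector bundle `TM`, making it a complex line
bundle, and `h` is a smooth Hermitian product on it (`ℂ`-linear in the second variable). -/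
structure IsHermitianLineBundle
    (J : ∀ x : M, TangentSpace (𝓡 2) x →ₗ[ℝ] TangentSpace (𝓡 2) x)
    (h : ∀ x : M, TangentSpace (𝓡 2) x → TangentSpace (𝓡 2) x → ℂ) : Prop where
  sq_eq_neg (x : M) (v : TangentSpace (𝓡 2) x) : J x (J x v) = -v
  rank_one (x : M) (e v : TangentSpace (𝓡 2) x) (he : e ≠ 0) : ∃ c : ℂ, v = complexSMul (J x) c e
  conj_symm (x : M) (u v : TangentSpace (𝓡 2) x) : h x u v = starRingEnd ℂ (h x v u)
  add_right (x : M) (u v w : TangentSpace (𝓡 2) x) : h x u (v + w) = h x u v + h x u w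
  smul_right (x : M) (c : ℂ) (u v : TangentSpace (𝓡 2) x) :
    h x u (complexSMul (J x) c v) = c * h x u v
  pos (x : M) (v : TangentSpace (𝓡 2) x) (hv : v ≠ 0) : 0 < (h x v v).re
  smooth_J (X : Π x : M, TangentSpace (𝓡 2) x) (x : M)
    (hX : ContMDiffAt (𝓡 2) (𝓡 2).tangent ∞ (asSection X) x) :
    ContMDiffAt (𝓡 2) (𝓡 2).tangent ∞ (asSection (fun y ↦ J y (X y))) x
  smooth_h (X Y : Π x : M, TangentSpace (𝓡 2) x) (x : M)
    (hX : ContMDiffAt (𝓡 2) (𝓡 2).tangent ∞ (asSection X) x)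
    (hY : ContMDiffAt (𝓡 2) (𝓡 2).tangent ∞ (asSection Y) x) :
    ContMDiffAt (𝓡 2) 𝓘(ℝ, ℂ) ∞ (fun y ↦ h y (X y) (Y y)) x

/-- The connection is a connection on the complex line bundle `(TM, J)` (it commutes with `J`)
and is compatible with the Hermitian product `h`. -/
structure IsHermitianConnection
    (J : ∀ x : M, TangentSpace (𝓡 2) x →ₗ[ℝ] TangentSpace (𝓡 2) x)
    (h : ∀ x : M, TangentSpace (𝓡 2) x → TangentSpace (𝓡 2) x → ℂ)
    (cov : CovariantDerivative (𝓡 2) (EuclideanSpace ℝ (Fin 2))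
      (fun x : M ↦ TangentSpace (𝓡 2) x)) : Prop where
  commutes (X : Π x : M, TangentSpace (𝓡 2) x) (x : M) (v : TangentSpace (𝓡 2) x)
    (hX : MDifferentiableAt (𝓡 2) (𝓡 2).tangent (asSection X) x) :
    cov (fun y ↦ J y (X y)) x v = J x (cov X x v)
  deriv_h (X Y : Π x : M, TangentSpace (𝓡 2) x) (x : M) (v : TangentSpace (𝓡 2) x)
    (hX : MDifferentiableAt (𝓡 2) (𝓡 2).tangent (asSection X) x)
    (hY : MDifferentiableAt (𝓡 2) (𝓡 2).tangent (asSection Y) x) :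
    mvfderiv (𝓡 2) (fun y ↦ h y (X y) (Y y)) x v = h x (cov X x v) (Y x) + h x (X x) (cov Y x v)

/-- `Ω` is the curvature form of the connection on the complex line bundle `(TM, J)`: the
endomorphism `R(X, Y)` is multiplication by the complex number `Ω(X, Y)`. -/
def IsCurvatureForm
    (J : ∀ x : M, TangentSpace (𝓡 2) x →ₗ[ℝ] TangentSpace (𝓡 2) x)
    (cov : CovariantDerivative (𝓡 2) (EuclideanSpace ℝ (Fin 2))
      (fun x : M ↦ TangentSpace (𝓡 2) x))
    (Ω : ∀ x : M, TangentSpace (𝓡 2) x → TangentSpace (𝓡 2) x → ℂ) : Prop :=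
  ∀ (x : M) (X Y Z : Π x : M, TangentSpace (𝓡 2) x),
    ContMDiffAt (𝓡 2) (𝓡 2).tangent ∞ (asSection X) x →
    ContMDiffAt (𝓡 2) (𝓡 2).tangent ∞ (asSection Y) x →
    ContMDiffAt (𝓡 2) (𝓡 2).tangent ∞ (asSection Z) x →
      curvature cov X Y Z x = complexSMul (J x) (Ω x (X x) (Y x)) (Z x)

open scoped Classical in
/-- The curvature form of a connection on the complex line bundle `(TM, J)`: its value at `(u, v)`
is the complex number by which the endomorphism `R(u, v)` acts (`0` if there is none, i.e. if
`R(u, v)` is not complex linear). -/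
def curvatureForm
    (J : ∀ x : M, TangentSpace (𝓡 2) x →ₗ[ℝ] TangentSpace (𝓡 2) x)
    (cov : CovariantDerivative (𝓡 2) (EuclideanSpace ℝ (Fin 2))
      (fun x : M ↦ TangentSpace (𝓡 2) x))
    (x : M) (u v : TangentSpace (𝓡 2) x) : ℂ :=
  if hc : ∃ c : ℂ, ∀ w, curvatureTensor cov x u v w = complexSMul (J x) c w then hc.choose else 0

variable (M) in
/-- An orientation of a smooth surface: an orientation of every tangent plane which is, locally,
the one given by a smooth frame. -/
structure SurfaceOrientation where
  orientation (x : M) : Orientation ℝ (TangentSpace (𝓡 2) x) (Fin 2)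
  exists_frame (x : M) : ∃ (U : Set M) (e : Fin 2 → Π y : M, TangentSpace (𝓡 2) y),
    IsOpen U ∧ x ∈ U ∧ (∀ i, ContMDiffOn (𝓡 2) (𝓡 2).tangent ∞ (asSection (e i)) U) ∧
      ∀ y ∈ U, ∃ b : Module.Basis (Fin 2) ℝ (TangentSpace (𝓡 2) y),
        (∀ i, b i = e i y) ∧ b.orientation = orientation y

variable [RiemannianBundle (fun x : M ↦ TangentSpace (𝓡 2) x)]

instance fact_finrank_tangentSpace (x : M) :
    Fact (Module.finrank ℝ (TangentSpace (𝓡 2) x) = 2) :=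
  ⟨finrank_euclideanSpace_fin (𝕜 := ℝ) (n := 2)⟩

namespace SurfaceOrientation

variable (o : SurfaceOrientation M)

/-- The Riemannian area form `⋆1`: the alternating form with value `1` on positively oriented
orthonormal bases. -/
def areaForm (x : M) (u v : TangentSpace (𝓡 2) x) : ℝ := (o.orientation x).areaForm u v

/-- The complex structure `j`, rotation by a right angle in the positive sense. -/
def complexStructure (x : M) : TangentSpace (𝓡 2) x →ₗ[ℝ] TangentSpace (𝓡 2) x :=
  (o.orientation x).rightAngleRotation.toLinearEquiv.toLinearMap

/-- The complex structure is the solution of `g(j u, v) = ⋆1(u, v)`. -/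
theorem inner_complexStructure (x : M) (u v : TangentSpace (𝓡 2) x) :
    inner ℝ (o.complexStructure x u) v = o.areaForm x u v :=
  (o.orientation x).inner_rightAngleRotation_left u v

/-- The Hermitian product `g + √-1 ⋆1`. -/
def hermitianProduct (x : M) (u v : TangentSpace (𝓡 2) x) : ℂ :=
  (inner ℝ u v : ℝ) + Complex.I * (o.areaForm x u v : ℝ)

end SurfaceOrientation

variable [IsContMDiffRiemannianBundle (𝓡 2) ∞ (EuclideanSpace ℝ (Fin 2))
  (fun x : M ↦ TangentSpace (𝓡 2) x)]

/-- The sectional curvature of the plane spanned by `u` and `v`. -/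
def sectionalCurvature (x : M) (u v : TangentSpace (𝓡 2) x) : ℝ :=
  inner ℝ (curvatureTensor (leviCivita (𝓡 2) M) x u v v) u /
    (inner ℝ u u * inner ℝ v v - inner ℝ u v ^ 2)

/-- The sectional curvature of a surface as a function on the surface: the sectional curvature of
the tangent plane, computed in some basis. -/
def gaussianCurvature (x : M) : ℝ :=
  let b : Module.Basis (Fin 2) ℝ (TangentSpace (𝓡 2) x) :=
    Module.finBasisOfFinrankEq ℝ _ Fact.out
  sectionalCurvature x (b 0) (b 1)

end Surface

/-!
The computation takes place in a local orthonormal frame `e, j e`, where `e` is a smooth unit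
vector field and `j` the rotation by a right angle (`exists_unit_field`). The rotation `j` is smooth
because it is a smooth expression in the metric and in any oriented frame
(`exists_complexStructure_eq`).

The inner products of the frame vectors are constant, so Koszul's formula only sees the bracket
`B = [e, j e]`: with the one-form `β = g(B, ·)` it reads `∇e = -β ⊗ j e` and `∇(j e) = β ⊗ e`
(`leviCivita_unitField`, `leviCivita_rotate_unitField`). Hence `∇` commutes with `j`
(`leviCivita_rotate`), which together with the metric property makes it a Hermitian connection.
Differentiating once more, and using that `[X, Y]` acts on functions as the commutator of `X` and
`Y` (`mvfderiv_mlieBracket`), gives `R(X, Y) = -dβ(X, Y) j` (`curvature_eq_dualExtDeriv`).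

The form `dβ` is tensorial and alternating, so on a surface it is `k ⋆1` with the smooth function
`k = dβ(e, j e)`. Thus `R(u, v) = -k ⋆1(u, v) j`. Multiplication by `√-1` being `j`, the curvature
form is `-√-1 k ⋆1`, while `g(R(u, v)v, u) = k ⋆1(u, v) ^ 2`, which by Lagrange's identity is `k`
times the Gram determinant of `u, v`. Therefore `k` is the sectional curvature in every basis.
-/

/-! ### Derivatives of functions along vector fields -/

section DirectionalDerivative

variable {E : Type*} [NormedAddCommGroup E] [NormedSpace ℝ E]
  {H : Type*} [TopologicalSpace H] {I : ModelWithCorners ℝ E H}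
  {M : Type*} [TopologicalSpace M] [ChartedSpace H M]

theorem mvfderiv_congr_of_eventuallyEq {F : Type*} [NormedAddCommGroup F] [NormedSpace ℝ F]
    {f g : M → F} {x : M} (h : f =ᶠ[𝓝 x] g) (v : TangentSpace I x) :
    mvfderiv I f x v = mvfderiv I g x v := by
  change NormedSpace.fromTangentSpace (f x) (mfderiv I 𝓘(ℝ, F) f x v) =
    NormedSpace.fromTangentSpace (g x) (mfderiv I 𝓘(ℝ, F) g x v)
  rw [h.mfderiv_eq]
  rfl

/-- The derivative of a `C^n` function along a `C^m` vector field is of class `C^m`, if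
`m + 1 ≤ n`. -/
theorem ContMDiffAt.mvfderiv_apply [IsManifold I 1 M] {m n : ℕ∞ω} {f : M → ℝ}
    {X : Π x : M, TangentSpace I x} {x : M} (hf : CMDiffAt n f x) (hX : CMDiffAt m (T% X) x)
    (hmn : m + 1 ≤ n) : CMDiffAt m (fun y ↦ mvfderiv I f y (X y)) x := by
  have h1 := hf.mfderiv_const hmn
  have h2 := ContMDiffAt.clm_apply_of_inCoordinates (b₁ := id) (b₂ := f) (v := X) h1 hX
    (hf.of_le (le_self_add.trans hmn))
  exact (contMDiff_snd_tangentBundle_modelSpace ℝ 𝓘(ℝ, ℝ)).contMDiffAt.comp x h2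

theorem mvfderiv_comp_extChartAt [IsManifold I 1 M] {g : E → ℝ} {x y : M}
    (hy : y ∈ (extChartAt I x).source) (hg : DifferentiableAt ℝ g (extChartAt I x y))
    (v : TangentSpace I y) :
    mvfderiv I (g ∘ extChartAt I x) y v =
      fderiv ℝ g (extChartAt I x y) (mfderiv I 𝓘(ℝ, E) (extChartAt I x) y v) := by
  have hφ : MDifferentiableAt I 𝓘(ℝ, E) (extChartAt I x) y :=
    mdifferentiableAt_extChartAt (by simpa using hy)
  have := mfderiv_comp_apply (I' := 𝓘(ℝ, E)) (I'' := 𝓘(ℝ, ℝ)) y hg.mdifferentiableAt hφ v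
  change mfderiv I 𝓘(ℝ, ℝ) (g ∘ extChartAt I x) y v = _
  rw [this, mfderiv_eq_fderiv]
  rfl

/-- In a chart, a vector field is the pushforward of the field that represents it. -/
theorem mfderiv_extChartAt_apply_eq [IsManifold I 1 M] [CompleteSpace E] {x : M}
    (X : Π x : M, TangentSpace I x) :
    ∀ᶠ y in 𝓝 x, mfderiv I 𝓘(ℝ, E) (extChartAt I x) y (X y) =
      mpullbackWithin 𝓘(ℝ, E) I (extChartAt I x).symm X (Set.range I) (extChartAt I x y) := by
  have h := eventuallyEq_mpullback_mpullbackWithin_extChartAt (I := I) (s := Set.univ) (x := x) X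
  rw [nhdsWithin_univ] at h
  filter_upwards [h, extChartAt_source_mem_nhds (I := I) x] with y hy hys
  conv_lhs => rw [hy]
  rw [mpullback_apply]
  exact (isInvertible_mfderiv_extChartAt hys).self_apply_inverse _

/-- The Lie bracket acts on functions as a commutator: `[X, Y] f = X (Y f) - Y (X f)`. The identity
is transported from the model space by a chart. -/
theorem mvfderiv_mlieBracket [IsManifold I 2 M] [I.Boundaryless] [CompleteSpace E] {f : M → ℝ}
    {X Y : Π x : M, TangentSpace I x} {x : M} (hf : CMDiffAt 2 f x) (hX : MDiffAt (T% X) x)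
    (hY : MDiffAt (T% Y) x) :
    mvfderiv I f x (mlieBracket I X Y x) =
      mvfderiv I (fun y ↦ mvfderiv I f y (Y y)) x (X x) -
        mvfderiv I (fun y ↦ mvfderiv I f y (X y)) x (Y x) := by
  have : IsManifold I 1 M := .of_le (n := 2) one_le_two
  set φ := extChartAt I x with hφ
  set f' : E → ℝ := f ∘ φ.symm with hf'
  have hx : x ∈ φ.source := mem_extChartAt_source x
  have hcf' : ContDiffAt ℝ 2 f' (φ x) := by
    have := (contMDiffAt_iff_source_of_mem_source (mem_chart_source H x)).1 hf
    rw [I.range_eq_univ, contMDiffWithinAt_univ] at this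
    exact this.contDiffAt
  -- the directional derivative along `Z` in the chart
  have key (Z : Π x : M, TangentSpace I x) : (fun y ↦ mvfderiv I f y (Z y)) =ᶠ[𝓝 x]
      (fun z ↦ fderiv ℝ f' z (mpullbackWithin 𝓘(ℝ, E) I φ.symm Z (Set.range I) z)) ∘ φ := by
    have hd : ∀ᶠ y in 𝓝 x, DifferentiableAt ℝ f' (φ y) :=
      (continuousAt_extChartAt (I := I) x).eventually
        ((hcf'.eventually (by simp)).mono fun y hy ↦ hy.differentiableAt (by simp))
    filter_upwards [hd, mfderiv_extChartAt_apply_eq (x := x) Z,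
      extChartAt_source_mem_nhds (I := I) x] with y hyd hyZ hys
    have he : f =ᶠ[𝓝 y] f' ∘ φ := by
      filter_upwards [extChartAt_source_mem_nhds' (I := I) hys] with w hw
      simp [hf', φ.left_inv hw]
    rw [mvfderiv_congr_of_eventuallyEq he, mvfderiv_comp_extChartAt hys hyd, hyZ]
    rfl
  have hdiff {Z : Π x : M, TangentSpace I x} (hZ : MDiffAt (T% Z) x) :
      DifferentiableAt ℝ (mpullbackWithin 𝓘(ℝ, E) I φ.symm Z (Set.range I)) (φ x) := by
    have := MDifferentiableWithinAt.differentiableWithinAt_mpullbackWithin_vectorField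
      (s := Set.univ) (x := x) (V := Z) (hZ.mdifferentiableWithinAt)
    rw [Set.preimage_univ, Set.univ_inter, I.range_eq_univ] at this
    rw [I.range_eq_univ]
    exact differentiableWithinAt_univ.1 this
  have hdf' : DifferentiableAt ℝ (fderiv ℝ f') (φ x) :=
    (hcf'.fderiv_right (m := 1) (by norm_num)).differentiableAt (by simp)
  have outer {Z : Π x : M, TangentSpace I x} (hZ : MDiffAt (T% Z) x)
      (W : Π x : M, TangentSpace I x) :
      mvfderiv I (fun y ↦ mvfderiv I f y (Z y)) x (W x) =
        fderiv ℝ (fun z ↦ fderiv ℝ f' z (mpullbackWithin 𝓘(ℝ, E) I φ.symm Z (Set.range I) z)) (φ x)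
          (mpullbackWithin 𝓘(ℝ, E) I φ.symm W (Set.range I) (φ x)) := by
    rw [mvfderiv_congr_of_eventuallyEq (key Z), mvfderiv_comp_extChartAt hx
      (hdf'.clm_apply (hdiff hZ)), (mfderiv_extChartAt_apply_eq (x := x) W).self_of_nhds]
  rw [outer hY, outer hX]
  refine Eq.trans ?_ (fderiv_apply_lieBracket hcf' (by simp) (hdiff hY) (hdiff hX))
  have he : f =ᶠ[𝓝 x] f' ∘ φ := by
    filter_upwards [extChartAt_source_mem_nhds (I := I) x] with w hw
    simp [hf', φ.left_inv hw]
  rw [mvfderiv_congr_of_eventuallyEq he, mvfderiv_comp_extChartAt hx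
    (hcf'.differentiableAt (by simp)), ← mlieBracketWithin_univ, mlieBracketWithin_apply]
  refine congrArg (fderiv ℝ f' (φ x))
    (((isInvertible_mfderiv_extChartAt hx).self_apply_inverse _).trans ?_)
  rw [Set.preimage_univ, Set.univ_inter, I.range_eq_univ]
  exact congrFun (lieBracketWithin_univ (𝕜 := ℝ) (E := E)) _

end DirectionalDerivative

/-! ### Oriented Euclidean planes -/

section OrientedPlane

variable {V : Type*} [NormedAddCommGroup V] [InnerProductSpace ℝ V]
  [Fact (Module.finrank ℝ V = 2)] (o : Orientation ℝ V (Fin 2))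

/-- The product of two values of the area form is a Gram determinant. -/
theorem Orientation.areaForm_mul_areaForm (a b v w : V) :
    o.areaForm a b * o.areaForm v w =
      inner ℝ a v * inner ℝ b w - inner ℝ b v * inner ℝ a w := by
  rcases eq_or_ne a 0 with rfl | ha
  · simp
  refine mul_left_cancel₀ (pow_ne_zero 2 (norm_ne_zero_iff.2 ha)) ?_
  linear_combination -o.areaForm a b * o.inner_mul_areaForm_sub a v w
    + inner ℝ a v * o.inner_mul_inner_add_areaForm_mul_areaForm a b w
    - inner ℝ a w * o.inner_mul_inner_add_areaForm_mul_areaForm a b v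

/-- The rotation by a right angle in terms of an arbitrary pair of vectors. -/
theorem Orientation.areaForm_smul_rightAngleRotation (a b v : V) :
    o.areaForm a b • o.rightAngleRotation v = inner ℝ a v • b - inner ℝ b v • a := by
  refine ext_inner_right ℝ fun w ↦ ?_
  rw [real_inner_smul_left, o.inner_rightAngleRotation_left, inner_sub_left, real_inner_smul_left,
    real_inner_smul_left, o.areaForm_mul_areaForm]

theorem Orientation.areaForm_pos_of_orientation_eq (b : Module.Basis (Fin 2) ℝ V)
    (hb : b.orientation = o) : 0 < o.areaForm (b 0) (b 1) := by
  let e : OrthonormalBasis (Fin 2) ℝ V := o.finOrthonormalBasis two_pos Fact.out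
  have he : e.toBasis.orientation = o := o.finOrthonormalBasis_orientation two_pos Fact.out
  have h := (e.toBasis.orientation_eq_iff_det_pos b).1 (he.trans hb.symm)
  rw [o.areaForm_to_volumeForm, o.volumeForm_robust e he]
  have hv : ![b 0, b 1] = ⇑b := funext fun i ↦ by fin_cases i <;> rfl
  rwa [hv]

theorem Orientation.areaForm_eq_sqrt_of_orientation_eq (b : Module.Basis (Fin 2) ℝ V)
    (hb : b.orientation = o) : o.areaForm (b 0) (b 1) =
      √(inner ℝ (b 0) (b 0) * inner ℝ (b 1) (b 1) - inner ℝ (b 0) (b 1) ^ 2) := by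
  rw [eq_comm, Real.sqrt_eq_iff_mul_self_eq_of_pos (o.areaForm_pos_of_orientation_eq b hb),
    o.areaForm_mul_areaForm, real_inner_comm (b 0) (b 1)]
  ring

/-- The expansion of a vector in the orthonormal basis `e, j e` given by a unit vector `e`. -/
theorem Orientation.eq_smul_add_smul_rightAngleRotation {e : V} (he : inner ℝ e e = (1 : ℝ))
    (v : V) :
    v = inner ℝ e v • e + inner ℝ (o.rightAngleRotation e) v • o.rightAngleRotation e := by
  refine ext_inner_right ℝ fun w ↦ ?_
  have := o.inner_mul_inner_add_areaForm_mul_areaForm e v w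
  rw [← real_inner_self_eq_norm_sq, he] at this
  simp only [inner_add_left, real_inner_smul_left, o.inner_rightAngleRotation_left]
  linarith

/-- An alternating bilinear form is the area form times its value on the orthonormal basis
`e, j e`. -/
theorem Orientation.bilin_eq_mul_areaForm {e : V} (he : inner ℝ e e = (1 : ℝ))
    (β : V →ₗ[ℝ] V →ₗ[ℝ] ℝ) (hβ : ∀ v, β v v = 0) (v w : V) :
    β v w = β e (o.rightAngleRotation e) * o.areaForm v w := by
  have hsymm : β (o.rightAngleRotation e) e = -β e (o.rightAngleRotation e) := by
    have := hβ (e + o.rightAngleRotation e)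
    simp only [map_add, LinearMap.add_apply, hβ] at this
    linarith
  have hω := o.inner_mul_areaForm_sub e v w
  rw [← real_inner_self_eq_norm_sq, he] at hω
  rw [← one_mul (o.areaForm v w), ← hω]
  conv_lhs => rw [o.eq_smul_add_smul_rightAngleRotation he v,
    o.eq_smul_add_smul_rightAngleRotation he w]
  simp only [map_add, map_smul, LinearMap.add_apply, LinearMap.smul_apply, hβ, hsymm,
    o.inner_rightAngleRotation_left, smul_eq_mul]
  ring

theorem Orientation.areaForm_ne_zero_of_linearIndependent {u v : V}
    (h : LinearIndependent ℝ ![u, v]) : o.areaForm u v ≠ 0 := by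
  intro h0
  have hp := LinearIndependent.pair_iff.1 h
  have hv : inner ℝ u v • u + (-inner ℝ u u : ℝ) • v = 0 := by
    refine ext_inner_right ℝ fun w ↦ ?_
    have := o.inner_mul_inner_add_areaForm_mul_areaForm u v w
    rw [h0, ← real_inner_self_eq_norm_sq] at this
    rw [inner_add_left, real_inner_smul_left, real_inner_smul_left, inner_zero_left]
    linarith
  have hu : u = 0 := by simpa using (hp _ _ hv).2
  exact one_ne_zero (hp 1 0 (by simp [hu])).1

end OrientedPlane

/-! ### The complex structure of an oriented surface -/

theorem contMDiffAt_inv_sqrt {M : Type*} [TopologicalSpace M]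
    [ChartedSpace (EuclideanSpace ℝ (Fin 2)) M] {f : M → ℝ} {x : M}
    (hf : ContMDiffAt (𝓡 2) 𝓘(ℝ) ∞ f x) (h : 0 < f x) :
    ContMDiffAt (𝓡 2) 𝓘(ℝ) ∞ (fun y ↦ (√(f y))⁻¹) x := by
  have hg : ContDiffAt ℝ ∞ (fun t : ℝ ↦ (√t)⁻¹) (f x) :=
    (Real.contDiffAt_sqrt h.ne').inv (Real.sqrt_ne_zero'.2 h)
  exact hg.comp_contMDiffAt hf

noncomputable section ComplexStructure

variable {M : Type*} [TopologicalSpace M] [ChartedSpace (EuclideanSpace ℝ (Fin 2)) M]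
  [IsManifold (𝓡 2) ∞ M] [RiemannianBundle (fun x : M ↦ TangentSpace (𝓡 2) x)]
  [IsContMDiffRiemannianBundle (𝓡 2) ∞ (EuclideanSpace ℝ (Fin 2))
    (fun x : M ↦ TangentSpace (𝓡 2) x)]

/-- The vector field `X` is of class `C^n` at `x`. -/
abbrev ContMDiffFieldAt (n : ℕ∞ω) (X : Π x : M, TangentSpace (𝓡 2) x) (x : M) : Prop :=
  ContMDiffAt (𝓡 2) (𝓡 2).tangent n (asSection X) x

/-- The vector field `e` is smooth and of length one on the open set `U`. -/
structure IsUnitFieldOn (e : Π y : M, TangentSpace (𝓡 2) y) (U : Set M) : Prop where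
  isOpen : IsOpen U
  contMDiffAt {y : M} (hy : y ∈ U) : ContMDiffFieldAt ∞ e y
  inner_self {y : M} (hy : y ∈ U) : inner ℝ (e y) (e y) = (1 : ℝ)

/-- The vector field `X` is differentiable at `x`. -/
abbrev MDifferentiableFieldAt (X : Π x : M, TangentSpace (𝓡 2) x) (x : M) : Prop :=
  MDifferentiableAt (𝓡 2) (𝓡 2).tangent (asSection X) x

theorem contMDiffAt_inner {n : ℕ∞} {X Y : Π x : M, TangentSpace (𝓡 2) x} {x : M}
    (hX : ContMDiffFieldAt n X x) (hY : ContMDiffFieldAt n Y x) :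
    ContMDiffAt (𝓡 2) 𝓘(ℝ) n (fun y ↦ inner ℝ (X y) (Y y)) x := by
  have : IsContMDiffRiemannianBundle (𝓡 2) n (EuclideanSpace ℝ (Fin 2))
    (fun x : M ↦ TangentSpace (𝓡 2) x) := .of_le (n := ∞) (by exact_mod_cast le_top)
  exact ContMDiffAt.inner_bundle (F := EuclideanSpace ℝ (Fin 2))
    (E := fun x : M ↦ TangentSpace (𝓡 2) x) (b := fun y ↦ y) hX hY

namespace SurfaceOrientation

variable (o : SurfaceOrientation M)

/-- The complex structure in terms of a local smooth frame `a, b`. -/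
theorem exists_complexStructure_eq (x : M) :
    ∃ (U : Set M) (a b : Π y : M, TangentSpace (𝓡 2) y) (s : M → ℝ), IsOpen U ∧ x ∈ U ∧
      (∀ y ∈ U, ContMDiffFieldAt ∞ a y ∧ ContMDiffFieldAt ∞ b y ∧
        ContMDiffAt (𝓡 2) 𝓘(ℝ) ∞ s y ∧ a y ≠ 0 ∧ ∀ v,
          o.complexStructure y v = s y • (inner ℝ (a y) v • b y - inner ℝ (b y) v • a y)) := by
  obtain ⟨U, e, hU, hx, he, hb⟩ := o.exists_frame x
  have hs (i : Fin 2) {y : M} (hy : y ∈ U) : ContMDiffFieldAt ∞ (e i) y :=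
    (he i y hy).contMDiffAt (hU.mem_nhds hy)
  refine ⟨U, e 0, e 1, fun y ↦ (√(inner ℝ (e 0 y) (e 0 y) * inner ℝ (e 1 y) (e 1 y) -
    inner ℝ (e 0 y) (e 1 y) ^ 2))⁻¹, hU, hx, fun y hy ↦ ?_⟩
  obtain ⟨b, hbe, hbo⟩ := hb y hy
  have hpos := (o.orientation y).areaForm_pos_of_orientation_eq b hbo
  have hsqrt := (o.orientation y).areaForm_eq_sqrt_of_orientation_eq b hbo
  rw [hbe, hbe] at hpos hsqrt
  refine ⟨hs 0 hy, hs 1 hy, contMDiffAt_inv_sqrt ?_ ?_, ?_, fun v ↦ ?_⟩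
  · exact ((contMDiffAt_inner (hs 0 hy) (hs 0 hy)).mul
      (contMDiffAt_inner (hs 1 hy) (hs 1 hy))).sub ((contMDiffAt_inner (hs 0 hy) (hs 1 hy)).pow 2)
  · rwa [hsqrt, Real.sqrt_pos] at hpos
  · rw [← hbe]
    exact b.ne_zero 0
  · beta_reduce
    rw [← (o.orientation y).areaForm_smul_rightAngleRotation, ← hsqrt, inv_smul_smul₀ hpos.ne']
    rfl

theorem contMDiffAt_complexStructure {n : ℕ∞} {X : Π x : M, TangentSpace (𝓡 2) x} {x : M}
    (hX : ContMDiffFieldAt n X x) : ContMDiffFieldAt n (fun y ↦ o.complexStructure y (X y)) x := by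
  obtain ⟨U, a, b, s, hU, hx, h⟩ := o.exists_complexStructure_eq x
  have hn : (n : ℕ∞ω) ≤ ∞ := by exact_mod_cast le_top
  obtain ⟨ha, hb, hs, -, -⟩ := h x hx
  have ha := ha.of_le hn
  have hb := hb.of_le hn
  -- near `x` the field `j X` is a smooth combination of the frame `a, b`
  refine ((hs.of_le hn).smul_section (((contMDiffAt_inner ha hX).smul_section hb).sub_section
    ((contMDiffAt_inner hb hX).smul_section ha))).congr_of_eventuallyEq ?_
  filter_upwards [hU.mem_nhds hx] with y hy
  simp [(h y hy).2.2.2.2]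

theorem mdifferentiableAt_complexStructure {X : Π x : M, TangentSpace (𝓡 2) x} {x : M}
    (hX : MDifferentiableFieldAt X x) :
    MDifferentiableFieldAt (fun y ↦ o.complexStructure y (X y)) x := by
  obtain ⟨U, a, b, s, hU, hx, h⟩ := o.exists_complexStructure_eq x
  obtain ⟨ha, hb, hs, -, -⟩ := h x hx
  have ha := ha.mdifferentiableAt (by simp)
  have hb := hb.mdifferentiableAt (by simp)
  refine ((hs.mdifferentiableAt (by simp)).smul_section
    (mdifferentiableAt_sub_section ((mdifferentiableAt_inner _ ha hX).smul_section hb)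
    ((mdifferentiableAt_inner _ hb hX).smul_section ha))).congr_of_eventuallyEq ?_
  filter_upwards [hU.mem_nhds hx] with y hy
  simp [(h y hy).2.2.2.2]

/-- Every point has an open neighbourhood with a smooth vector field of length one. -/
theorem exists_unit_field (o : SurfaceOrientation M) (x : M) :
    ∃ (U : Set M) (e : Π y : M, TangentSpace (𝓡 2) y), x ∈ U ∧ IsUnitFieldOn e U := by
  obtain ⟨U, a, b, s, hU, hx, h⟩ := o.exists_complexStructure_eq x
  refine ⟨U, fun y ↦ (√(inner ℝ (a y) (a y)))⁻¹ • a y, hx, hU, fun {y} hy ↦ ?_, fun {y} hy ↦ ?_⟩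
  all_goals obtain ⟨ha, -, -, h0, -⟩ := h y hy
  · exact (contMDiffAt_inv_sqrt (contMDiffAt_inner ha ha) (real_inner_self_pos.2 h0)).smul_section
      ha
  · have : ‖a y‖ ≠ 0 := by simpa using h0
    rw [real_inner_smul_left, real_inner_smul_right, real_inner_self_eq_norm_sq,
      Real.sqrt_sq (norm_nonneg _)]
    field_simp

end SurfaceOrientation

end ComplexStructure

/-! ### The Levi-Civita connection in an orthonormal frame -/

noncomputable section OrthonormalFrame

variable {M : Type*} [TopologicalSpace M] [ChartedSpace (EuclideanSpace ℝ (Fin 2)) M]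
  [IsManifold (𝓡 2) ∞ M] [RiemannianBundle (fun x : M ↦ TangentSpace (𝓡 2) x)]

namespace SurfaceOrientation

variable (o : SurfaceOrientation M) {e : Π y : M, TangentSpace (𝓡 2) y} {U : Set M} {x : M}

/-- The vector field `j X`. -/
abbrev rotate (X : Π x : M, TangentSpace (𝓡 2) x) (x : M) : TangentSpace (𝓡 2) x :=
  o.complexStructure x (X x)

/-- The bracket `[e, j e]` of the vectors of an orthonormal frame. It is, up to sign, the vector
field dual to the connection form of the frame. -/
def frameBracket (e : Π y : M, TangentSpace (𝓡 2) y) : Π y : M, TangentSpace (𝓡 2) y :=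
  mlieBracket (𝓡 2) e (o.rotate e)

theorem inner_rotate_self (e : Π y : M, TangentSpace (𝓡 2) y) (y : M) :
    inner ℝ (e y) (o.rotate e y) = (0 : ℝ) := by
  rw [real_inner_comm]
  exact (o.orientation y).inner_rightAngleRotation_self _

theorem inner_rotate_rotate (e : Π y : M, TangentSpace (𝓡 2) y) (y : M) :
    inner ℝ (o.rotate e y) (o.rotate e y) = (inner ℝ (e y) (e y) : ℝ) :=
  (o.orientation y).inner_comp_rightAngleRotation _ _

theorem eq_smul_add_smul_rotate (he : IsUnitFieldOn e U) (hx : x ∈ U)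
    (v : TangentSpace (𝓡 2) x) :
    v = inner ℝ (e x) v • e x + inner ℝ (o.rotate e x) v • o.rotate e x :=
  (o.orientation x).eq_smul_add_smul_rightAngleRotation (he.inner_self hx) v

theorem complexStructure_rotate (e : Π y : M, TangentSpace (𝓡 2) y) (y : M) :
    o.complexStructure y (o.rotate e y) = -e y :=
  (o.orientation y).rightAngleRotation_rightAngleRotation _

variable [IsContMDiffRiemannianBundle (𝓡 2) ∞ (EuclideanSpace ℝ (Fin 2))
  (fun x : M ↦ TangentSpace (𝓡 2) x)]

/-- Compatibility of the Levi-Civita connection with the metric, for a single tangent vector. -/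
theorem _root_.mvfderiv_inner_apply {x : M} {Y Z : Π x : M, TangentSpace (𝓡 2) x}
    (hY : MDifferentiableFieldAt Y x) (hZ : MDifferentiableFieldAt Z x)
    (v : TangentSpace (𝓡 2) x) :
    mvfderiv (𝓡 2) (fun y ↦ inner ℝ (Y y) (Z y)) x v =
      inner ℝ (leviCivita (𝓡 2) M Y x v) (Z x) + inner ℝ (Y x) (leviCivita (𝓡 2) M Z x v) := by
  have := leviCivita_metric (X := extend (EuclideanSpace ℝ (Fin 2)) v)
    (mdifferentiableAt_extend ..) hY hZ
  rwa [extend_apply_self] at this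

/-- The derivative of the first vector of the frame `e, j e`: `∇_v e = -g([e, j e], v) j e`. -/
theorem leviCivita_unitField (he : IsUnitFieldOn e U) (hx : x ∈ U) (v : TangentSpace (𝓡 2) x) :
    leviCivita (𝓡 2) M e x v = -inner ℝ (o.frameBracket e x) v • o.rotate e x := by
  have hd : MDifferentiableFieldAt e x := (he.contMDiffAt hx).mdifferentiableAt (by simp)
  have hd' : MDifferentiableFieldAt (o.rotate e) x := o.mdifferentiableAt_complexStructure hd
  have hU := he.isOpen.mem_nhds hx
  -- the inner products of the frame are constant, so only brackets are left in Koszul's formula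
  have h11 (w : TangentSpace (𝓡 2) x) :
      mvfderiv (𝓡 2) (fun y ↦ inner ℝ (e y) (e y)) x w = (0 : ℝ) := by
    rw [mvfderiv_congr_of_eventuallyEq (g := fun _ ↦ (1 : ℝ))
      (by filter_upwards [hU] with y hy using he.inner_self hy), mvfderiv_const]
    rfl
  have h22 (w : TangentSpace (𝓡 2) x) :
      mvfderiv (𝓡 2) (fun y ↦ inner ℝ (o.rotate e y) (o.rotate e y)) x w = (0 : ℝ) := by
    simp only [o.inner_rotate_rotate, h11]
  have h12 (w : TangentSpace (𝓡 2) x) :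
      mvfderiv (𝓡 2) (fun y ↦ inner ℝ (e y) (o.rotate e y)) x w = (0 : ℝ) := by
    simp only [o.inner_rotate_self, mvfderiv_const]
    rfl
  have h21 (w : TangentSpace (𝓡 2) x) :
      mvfderiv (𝓡 2) (fun y ↦ inner ℝ (o.rotate e y) (e y)) x w = (0 : ℝ) := by
    simp only [real_inner_comm, h12]
  -- the component along `e`
  have hn (w : TangentSpace (𝓡 2) x) :
      inner ℝ (e x) (leviCivita (𝓡 2) M e x w) = (0 : ℝ) := by
    have := mvfderiv_inner_apply hd hd w
    rw [h11, real_inner_comm] at this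
    linarith
  -- the component along `j e`, first in the directions of the frame
  have h1 := leviCivita_apply hd hd hd'
  have h2 := leviCivita_apply hd' hd hd'
  simp only [koszulAux, h11, h12, h22, h21, mlieBracket_self, Pi.zero_apply, inner_zero_left]
    at h1 h2
  rw [mlieBracket_swap_apply (V := o.rotate e) (W := e), inner_neg_left] at h2
  have ht : inner ℝ (o.rotate e x) (leviCivita (𝓡 2) M e x v) =
      -(inner ℝ (o.frameBracket e x) v : ℝ) := by
    rw [real_inner_comm]
    conv_lhs => rw [o.eq_smul_add_smul_rotate he hx v]
    conv_rhs => rw [o.eq_smul_add_smul_rotate he hx v]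
    rw [map_add, map_smul, map_smul, inner_add_left, inner_add_right, real_inner_smul_left,
      real_inner_smul_left, real_inner_smul_right, real_inner_smul_right, h1, h2, frameBracket]
    ring
  rw [o.eq_smul_add_smul_rotate he hx (leviCivita (𝓡 2) M e x v), hn, ht]
  simp

/-- The derivative of the second vector of the frame: `∇_v (j e) = g([e, j e], v) e`, since
`g(e, j e)` and `g(j e, j e)` are constant. -/
theorem leviCivita_rotate_unitField (he : IsUnitFieldOn e U) (hx : x ∈ U)
    (v : TangentSpace (𝓡 2) x) :
    leviCivita (𝓡 2) M (o.rotate e) x v = inner ℝ (o.frameBracket e x) v • e x := by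
  have hd : MDifferentiableFieldAt e x := (he.contMDiffAt hx).mdifferentiableAt (by simp)
  have hd' : MDifferentiableFieldAt (o.rotate e) x := o.mdifferentiableAt_complexStructure hd
  have hU := he.isOpen.mem_nhds hx
  have h22 : mvfderiv (𝓡 2) (fun y ↦ inner ℝ (o.rotate e y) (o.rotate e y)) x v = (0 : ℝ) := by
    rw [mvfderiv_congr_of_eventuallyEq (g := fun _ ↦ (1 : ℝ)) (by
      filter_upwards [hU] with y hy using (o.inner_rotate_rotate e y).trans (he.inner_self hy)),
      mvfderiv_const]
    rfl
  have h12 : mvfderiv (𝓡 2) (fun y ↦ inner ℝ (e y) (o.rotate e y)) x v = (0 : ℝ) := by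
    simp only [o.inner_rotate_self, mvfderiv_const]
    rfl
  rw [mvfderiv_inner_apply hd' hd', real_inner_comm] at h22
  rw [mvfderiv_inner_apply hd hd', o.leviCivita_unitField he hx, real_inner_smul_left,
    o.inner_rotate_rotate, he.inner_self hx] at h12
  rw [o.eq_smul_add_smul_rotate he hx (leviCivita (𝓡 2) M (o.rotate e) x v)]
  have h0 : inner ℝ (o.rotate e x) (leviCivita (𝓡 2) M (o.rotate e) x v) = (0 : ℝ) := by linarith
  have h1 : inner ℝ (e x) (leviCivita (𝓡 2) M (o.rotate e) x v) =
    (inner ℝ (o.frameBracket e x) v : ℝ) := by linarith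
  rw [h0, h1]
  simp

/-- The Levi-Civita derivative of a field `Z = p e + q j e` in terms of its coefficients. -/
theorem leviCivita_frame (he : IsUnitFieldOn e U) (hx : x ∈ U) {p q : M → ℝ}
    {Z : Π y : M, TangentSpace (𝓡 2) y}
    (hp : MDifferentiableAt (𝓡 2) 𝓘(ℝ) p x) (hq : MDifferentiableAt (𝓡 2) 𝓘(ℝ) q x)
    (hZ : ∀ᶠ y in 𝓝 x, Z y = p y • e y + q y • o.rotate e y) (v : TangentSpace (𝓡 2) x) :
    leviCivita (𝓡 2) M Z x v =
      (mvfderiv (𝓡 2) p x v + q x * inner ℝ (o.frameBracket e x) v) • e x +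
      (mvfderiv (𝓡 2) q x v - p x * inner ℝ (o.frameBracket e x) v) • o.rotate e x := by
  have hd : MDifferentiableFieldAt e x := (he.contMDiffAt hx).mdifferentiableAt (by simp)
  have hd' : MDifferentiableFieldAt (o.rotate e) x := o.mdifferentiableAt_complexStructure hd
  have hs1 : MDifferentiableFieldAt (p • e) x := hp.smul_section hd
  have hs2 : MDifferentiableFieldAt (q • o.rotate e) x := hq.smul_section hd'
  have hs : MDifferentiableFieldAt (p • e + q • o.rotate e) x :=
    mdifferentiableAt_add_section hs1 hs2
  have hsZ : MDifferentiableFieldAt Z x := by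
    refine hs.congr_of_eventuallyEq ?_
    filter_upwards [hZ] with y hy
    simp [hy]
  have hc := (leviCivita (𝓡 2) M).isCovariantDerivativeOnUniv
  have : leviCivita (𝓡 2) M Z x = leviCivita (𝓡 2) M (p • e + q • o.rotate e) x :=
    hc.congr_of_eventuallyEq hsZ hs Filter.univ_mem hZ
  rw [this, hc.add hs1 hs2, hc.leibniz hd hp, hc.leibniz hd' hq]
  simp only [add_apply, smul_apply, ContinuousLinearMap.smulRight_apply]
  rw [o.leviCivita_unitField he hx, o.leviCivita_rotate_unitField he hx]
  module

/-- The Levi-Civita connection commutes with the complex structure: in the frame `e, j e`, applying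
`j` replaces the coefficients `(p, q)` by `(-q, p)`, which preserves the formula of
`leviCivita_frame`. -/
theorem leviCivita_rotate {X : Π y : M, TangentSpace (𝓡 2) y} (hX : MDifferentiableFieldAt X x)
    (v : TangentSpace (𝓡 2) x) :
    leviCivita (𝓡 2) M (o.rotate X) x v = o.complexStructure x (leviCivita (𝓡 2) M X x v) := by
  obtain ⟨U, e, hx, he⟩ := o.exists_unit_field x
  have hd : MDifferentiableFieldAt e x := (he.contMDiffAt hx).mdifferentiableAt (by simp)
  have hd' : MDifferentiableFieldAt (o.rotate e) x := o.mdifferentiableAt_complexStructure hd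
  have hp := mdifferentiableAt_inner (𝓡 2) hd hX
  have hq := mdifferentiableAt_inner (𝓡 2) hd' hX
  have hexp : ∀ᶠ y in 𝓝 x, X y = inner ℝ (e y) (X y) • e y +
      inner ℝ (o.rotate e y) (X y) • o.rotate e y := by
    filter_upwards [he.isOpen.mem_nhds hx] with y hy using o.eq_smul_add_smul_rotate he hy _
  rw [o.leviCivita_frame he hx hp hq hexp v,
    o.leviCivita_frame he hx (p := fun y ↦ -inner ℝ (o.rotate e y) (X y)) hq.neg hp ?_ v]
  · rw [mvfderiv_fun_neg, map_add, map_smul, map_smul, o.complexStructure_rotate]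
    simp only [neg_apply]
    module
  · filter_upwards [hexp] with y hy
    change o.complexStructure y (X y) = _
    conv_lhs => rw [hy]
    rw [map_add, map_smul, map_smul, o.complexStructure_rotate]
    module

end SurfaceOrientation

end OrthonormalFrame

/-! ### The curvature in an orthonormal frame -/

noncomputable section FrameCurvature

variable {M : Type*} [TopologicalSpace M] [ChartedSpace (EuclideanSpace ℝ (Fin 2)) M]
  [RiemannianBundle (fun x : M ↦ TangentSpace (𝓡 2) x)]

/-- The exterior derivative of the one-form `g(B, ·)`, evaluated on two vector fields:
`X g(B, Y) - Y g(B, X) - g(B, [X, Y])`. -/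
def dualExtDeriv (B X Y : Π x : M, TangentSpace (𝓡 2) x) (x : M) : ℝ :=
  mvfderiv (𝓡 2) (fun y ↦ inner ℝ (B y) (Y y)) x (X x) -
    mvfderiv (𝓡 2) (fun y ↦ inner ℝ (B y) (X y)) x (Y x) -
    inner ℝ (B x) (mlieBracket (𝓡 2) X Y x)

theorem dualExtDeriv_self (B X : Π x : M, TangentSpace (𝓡 2) x) (x : M) :
    dualExtDeriv B X X x = 0 := by
  simp [dualExtDeriv]

theorem dualExtDeriv_swap (B X Y : Π x : M, TangentSpace (𝓡 2) x) (x : M) :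
    dualExtDeriv B X Y x = -dualExtDeriv B Y X x := by
  rw [dualExtDeriv, dualExtDeriv, mlieBracket_swap_apply, inner_neg_right]
  ring

variable [IsManifold (𝓡 2) ∞ M] [IsContMDiffRiemannianBundle (𝓡 2) ∞ (EuclideanSpace ℝ (Fin 2))
  (fun x : M ↦ TangentSpace (𝓡 2) x)]

theorem dualExtDeriv_tensorial_left {x : M} {B Y : Π x : M, TangentSpace (𝓡 2) x}
    (hB : MDifferentiableFieldAt B x) :
    TensorialAt (𝓡 2) (EuclideanSpace ℝ (Fin 2)) (fun X ↦ dualExtDeriv B X Y x) x where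
  smul {f X} hf hX := by
    have h1 := mvfderiv_fun_mul hf (mdifferentiableAt_inner (𝓡 2) hB hX)
    simp [dualExtDeriv, inner_smul_right, h1, mlieBracket_smul_left hf hX, inner_add_right]
    ring
  add {X X'} hX hX' := by
    have h1 := mvfderiv_fun_add (mdifferentiableAt_inner (𝓡 2) hB hX)
      (mdifferentiableAt_inner (𝓡 2) hB hX')
    simp [dualExtDeriv, inner_add_right, h1, mlieBracket_add_left hX hX']
    ring

theorem dualExtDeriv_tensorial_right {x : M} {B X : Π x : M, TangentSpace (𝓡 2) x}
    (hB : MDifferentiableFieldAt B x) :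
    TensorialAt (𝓡 2) (EuclideanSpace ℝ (Fin 2)) (fun Y ↦ dualExtDeriv B X Y x) x where
  smul hf hY := by
    simp only [dualExtDeriv_swap B X, (dualExtDeriv_tensorial_left hB).smul hf hY, smul_neg]
  add hY hY' := by
    simp only [dualExtDeriv_swap B X, (dualExtDeriv_tensorial_left hB).add hY hY', neg_add]

namespace SurfaceOrientation

variable (o : SurfaceOrientation M) {e : Π y : M, TangentSpace (𝓡 2) y} {U : Set M} {x : M}

/-- The two-form `d g(B, ·)` is its value on the frame `e, j e` times the area form. -/
theorem dualExtDeriv_eq_mul_areaForm {B X Y : Π x : M, TangentSpace (𝓡 2) x}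
    (he : IsUnitFieldOn e U) (hx : x ∈ U) (hB : MDifferentiableFieldAt B x)
    (hX : MDifferentiableFieldAt X x) (hY : MDifferentiableFieldAt Y x) :
    dualExtDeriv B X Y x = dualExtDeriv B e (o.rotate e) x * o.areaForm x (X x) (Y x) := by
  have hd : MDifferentiableFieldAt e x := (he.contMDiffAt hx).mdifferentiableAt (by simp)
  have hd' : MDifferentiableFieldAt (o.rotate e) x := o.mdifferentiableAt_complexStructure hd
  have h1 (τ : Π x : M, TangentSpace (𝓡 2) x) (_ : MDifferentiableFieldAt τ x) :=
    dualExtDeriv_tensorial_left (Y := τ) hB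
  have h2 (σ : Π x : M, TangentSpace (𝓡 2) x) (_ : MDifferentiableFieldAt σ x) :=
    dualExtDeriv_tensorial_right (X := σ) hB
  let L : TangentSpace (𝓡 2) x →L[ℝ] TangentSpace (𝓡 2) x →L[ℝ] ℝ :=
    TensorialAt.mkHom₂ (fun X Y ↦ dualExtDeriv B X Y x) x h1 h2
  have hL {X Y : Π x : M, TangentSpace (𝓡 2) x} (hX : MDifferentiableFieldAt X x)
      (hY : MDifferentiableFieldAt Y x) : L (X x) (Y x) = dualExtDeriv B X Y x :=
    TensorialAt.mkHom₂_apply h1 h2 hX hY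
  have hLs (v : TangentSpace (𝓡 2) x) : L v v = 0 := dualExtDeriv_self ..
  have key := (o.orientation x).bilin_eq_mul_areaForm (he.inner_self hx)
    (LinearMap.mk₂ ℝ (fun v w ↦ L v w) (by simp) (by simp) (by simp) (by simp)) hLs (X x) (Y x)
  rw [← hL hX hY, ← hL hd hd']
  exact key

theorem contMDiffAt_frameBracket (he : IsUnitFieldOn e U) (hx : x ∈ U) :
    ContMDiffFieldAt ∞ (o.frameBracket e) x := by
  have h1 := he.contMDiffAt hx
  have h2 : ContMDiffFieldAt ∞ (o.rotate e) x := o.contMDiffAt_complexStructure h1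
  have : IsManifold (𝓡 2) (((⊤ : ℕ∞) : ℕ∞ω) + 1) M := by
    convert! (inferInstance : IsManifold (𝓡 2) ∞ M)
  have : IsManifold (𝓡 2) (minSmoothness ℝ 2) M := by
    rw [minSmoothness_of_isRCLikeNormedField]
    infer_instance
  exact ContMDiffAt.mlieBracket_vectorField (m := ⊤) (n := ⊤) h1 h2 (by simp)

theorem contMDiffAt_dualExtDeriv_frame (he : IsUnitFieldOn e U) (hx : x ∈ U) :
    ContMDiffAt (𝓡 2) 𝓘(ℝ) ∞ (dualExtDeriv (o.frameBracket e) e (o.rotate e)) x := by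
  have h1 := he.contMDiffAt hx
  have h2 : ContMDiffFieldAt ∞ (o.rotate e) x := o.contMDiffAt_complexStructure h1
  have hB := o.contMDiffAt_frameBracket he hx
  exact (((contMDiffAt_inner hB h2).mvfderiv_apply h1 (by simp)).sub
    ((contMDiffAt_inner hB h1).mvfderiv_apply h2 (by simp))).sub (contMDiffAt_inner hB hB)

/-- The curvature in an orthonormal frame: `R(X, Y) = -dβ(X, Y) j` for the one-form
`β = g([e, j e], ·)`. The second derivatives of the coefficients of `Z` cancel by
`mvfderiv_mlieBracket`. -/
theorem curvature_eq_dualExtDeriv (he : IsUnitFieldOn e U) (hx : x ∈ U)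
    {X Y Z : Π y : M, TangentSpace (𝓡 2) y} (hX : ContMDiffFieldAt 1 X x)
    (hY : ContMDiffFieldAt 1 Y x) (hZ : ContMDiffFieldAt 2 Z x) :
    curvature (leviCivita (𝓡 2) M) X Y Z x =
      -dualExtDeriv (o.frameBracket e) X Y x • o.complexStructure x (Z x) := by
  have hn : (2 : ℕ∞ω) ≤ ∞ := by norm_cast
  set B := o.frameBracket e with hBdef
  have hB : MDifferentiableFieldAt B x :=
    (o.contMDiffAt_frameBracket he hx).mdifferentiableAt (by simp)
  have hE : ContMDiffFieldAt 2 e x := (he.contMDiffAt hx).of_le hn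
  have hE' : ContMDiffFieldAt 2 (o.rotate e) x := o.contMDiffAt_complexStructure (n := 2) hE
  set p : M → ℝ := fun y ↦ inner ℝ (e y) (Z y) with hp_def
  set q : M → ℝ := fun y ↦ inner ℝ (o.rotate e y) (Z y) with hq_def
  have hp : ContMDiffAt (𝓡 2) 𝓘(ℝ) 2 p x := contMDiffAt_inner (n := 2) hE hZ
  have hq : ContMDiffAt (𝓡 2) 𝓘(ℝ) 2 q x := contMDiffAt_inner (n := 2) hE' hZ
  have hU := he.isOpen.mem_nhds hx
  have hexp {y : M} (hy : y ∈ U) : Z y = p y • e y + q y • o.rotate e y :=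
    o.eq_smul_add_smul_rotate he hy _
  have hexp' {y : M} (hy : y ∈ U) : ∀ᶠ w in 𝓝 y, Z w = p w • e w + q w • o.rotate e w := by
    filter_upwards [he.isOpen.mem_nhds hy] with w hw using hexp hw
  have hpd := hp.mdifferentiableAt (by simp)
  have hqd := hq.mdifferentiableAt (by simp)
  -- the derivative of `Z` along a field, in the frame
  have first (W : Π y : M, TangentSpace (𝓡 2) y) :
      ∀ᶠ y in 𝓝 x, leviCivita (𝓡 2) M Z y (W y) =
        (mvfderiv (𝓡 2) p y (W y) + q y * inner ℝ (B y) (W y)) • e y +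
        (mvfderiv (𝓡 2) q y (W y) - p y * inner ℝ (B y) (W y)) • o.rotate e y := by
    filter_upwards [hU, (contMDiffAt_iff_contMDiffAt_nhds (by simp)).1 hp,
      (contMDiffAt_iff_contMDiffAt_nhds (by simp)).1 hq] with y hy hpy hqy
    exact o.leviCivita_frame he hy (hpy.mdifferentiableAt (by simp))
      (hqy.mdifferentiableAt (by simp)) (hexp' hy) _
  have second {W : Π y : M, TangentSpace (𝓡 2) y} (hW : ContMDiffFieldAt 1 W x)
      (v : TangentSpace (𝓡 2) x) :
      leviCivita (𝓡 2) M (fun y ↦ leviCivita (𝓡 2) M Z y (W y)) x v =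
        (mvfderiv (𝓡 2) (fun y ↦ mvfderiv (𝓡 2) p y (W y)) x v +
          q x * mvfderiv (𝓡 2) (fun y ↦ inner ℝ (B y) (W y)) x v +
          mvfderiv (𝓡 2) q x v * inner ℝ (B x) (W x) +
          (mvfderiv (𝓡 2) q x (W x) - p x * inner ℝ (B x) (W x)) * inner ℝ (B x) v) • e x +
        (mvfderiv (𝓡 2) (fun y ↦ mvfderiv (𝓡 2) q y (W y)) x v -
          p x * mvfderiv (𝓡 2) (fun y ↦ inner ℝ (B y) (W y)) x v -
          mvfderiv (𝓡 2) p x v * inner ℝ (B x) (W x) -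
          (mvfderiv (𝓡 2) p x (W x) + q x * inner ℝ (B x) (W x)) * inner ℝ (B x) v) •
            o.rotate e x := by
    have hWp := (hp.mvfderiv_apply hW (by norm_num)).mdifferentiableAt (by simp)
    have hWq := (hq.mvfderiv_apply hW (by norm_num)).mdifferentiableAt (by simp)
    have hBW := mdifferentiableAt_inner (𝓡 2) hB (hW.mdifferentiableAt (by simp))
    rw [o.leviCivita_frame he hx (hWp.add (hqd.mul hBW)) (hWq.sub (hpd.mul hBW)) (first W),
      mvfderiv_add hWp (hqd.mul hBW), mvfderiv_sub hWq (hpd.mul hBW), mvfderiv_mul hqd hBW,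
      mvfderiv_mul hpd hBW]
    simp only [add_apply, sub_apply, smul_apply, smul_eq_mul, Pi.add_apply, Pi.sub_apply,
      Pi.mul_apply]
    congr 2 <;> ring
  have hXd := hX.mdifferentiableAt (by simp)
  have hYd := hY.mdifferentiableAt (by simp)
  rw [curvature, second hY, second hX,
    o.leviCivita_frame he hx hpd hqd (hexp' hx), mvfderiv_mlieBracket hp hXd hYd,
    mvfderiv_mlieBracket hq hXd hYd, hexp hx, map_add, map_smul, map_smul,
    o.complexStructure_rotate, dualExtDeriv]
  module

end SurfaceOrientation

end FrameCurvature

/-! ### The Hermitian line bundle, the curvature form and the Gauss curvature -/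

noncomputable section GaussCurvature

variable {M : Type*} [TopologicalSpace M] [ChartedSpace (EuclideanSpace ℝ (Fin 2)) M]
  [IsManifold (𝓡 2) ∞ M] [RiemannianBundle (fun x : M ↦ TangentSpace (𝓡 2) x)]

namespace SurfaceOrientation

variable (o : SurfaceOrientation M)

theorem inner_complexStructure_self (x : M) (v : TangentSpace (𝓡 2) x) :
    inner ℝ (o.complexStructure x v) v = (0 : ℝ) :=
  (o.orientation x).inner_rightAngleRotation_self v

theorem inner_complexStructure_complexStructure (x : M) (v w : TangentSpace (𝓡 2) x) :
    inner ℝ (o.complexStructure x v) (o.complexStructure x w) = (inner ℝ v w : ℝ) :=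
  (o.orientation x).inner_comp_rightAngleRotation v w

theorem areaForm_swap (x : M) (v w : TangentSpace (𝓡 2) x) :
    o.areaForm x v w = -o.areaForm x w v :=
  (o.orientation x).areaForm_swap v w

theorem inner_sq_add_areaForm_sq (x : M) (u v : TangentSpace (𝓡 2) x) :
    inner ℝ u v ^ 2 + o.areaForm x u v ^ 2 = (inner ℝ u u * inner ℝ v v : ℝ) := by
  rw [real_inner_self_eq_norm_sq, real_inner_self_eq_norm_sq]
  exact (o.orientation x).inner_sq_add_areaForm_sq u v

/-- A complex number is determined by its action on the tangent plane. -/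
theorem complexSMul_injective {x : M} {c d : ℂ}
    (h : ∀ v, complexSMul (o.complexStructure x) c v = complexSMul (o.complexStructure x) d v) :
    c = d := by
  have : Nontrivial (TangentSpace (𝓡 2) x) :=
    Module.nontrivial_of_finrank_pos (R := ℝ) (by
      rw [(fact_finrank_tangentSpace x).out]
      exact two_pos)
  obtain ⟨v, hv⟩ := exists_ne (0 : TangentSpace (𝓡 2) x)
  have hvv : (inner ℝ v v : ℝ) ≠ 0 := (real_inner_self_pos.2 hv).ne'
  have hre := congrArg (fun w : TangentSpace (𝓡 2) x ↦ (inner ℝ w v : ℝ)) (h v)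
  have him := congrArg (fun w : TangentSpace (𝓡 2) x ↦
    (inner ℝ w (o.complexStructure x v) : ℝ)) (h v)
  have h0 : inner ℝ v (o.complexStructure x v) = (0 : ℝ) := by
    rw [real_inner_comm, o.inner_complexStructure_self]
  simp only [complexSMul, inner_add_left, real_inner_smul_left, o.inner_complexStructure_self,
    mul_zero, add_zero] at hre
  simp only [complexSMul, inner_add_left, real_inner_smul_left, h0,
    o.inner_complexStructure_complexStructure, mul_zero, zero_add] at him
  exact Complex.ext (mul_right_cancel₀ hvv hre) (mul_right_cancel₀ hvv him)

/-- The Hermitian product as a combination of inner products, in the form used to differentiate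
it. -/
theorem hermitianProduct_eq_smul_add_smul (x : M) (u v : TangentSpace (𝓡 2) x) :
    o.hermitianProduct x u v =
      (inner ℝ u v : ℝ) • (1 : ℂ) + (inner ℝ (o.complexStructure x u) v : ℝ) • Complex.I := by
  rw [o.inner_complexStructure]
  simp [hermitianProduct, mul_comm]

variable [IsContMDiffRiemannianBundle (𝓡 2) ∞ (EuclideanSpace ℝ (Fin 2))
  (fun x : M ↦ TangentSpace (𝓡 2) x)]

theorem isHermitianLineBundle :
    IsHermitianLineBundle o.complexStructure o.hermitianProduct where
  sq_eq_neg x v := (o.orientation x).rightAngleRotation_rightAngleRotation v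
  rank_one x e v he := by
    have hee : (inner ℝ e e : ℝ) ≠ 0 := (real_inner_self_pos.2 he).ne'
    refine ⟨⟨inner ℝ e v / inner ℝ e e, o.areaForm x e v / inner ℝ e e⟩, ?_⟩
    refine ext_inner_right ℝ fun w ↦ ?_
    have h : inner ℝ e v * inner ℝ e w + o.areaForm x e v * o.areaForm x e w =
        inner ℝ e e * (inner ℝ v w : ℝ) := by
      rw [real_inner_self_eq_norm_sq]
      exact (o.orientation x).inner_mul_inner_add_areaForm_mul_areaForm e v w
    simp only [complexSMul, inner_add_left, real_inner_smul_left, o.inner_complexStructure]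
    field_simp
    linarith
  conj_symm x u v := by
    have h1 := real_inner_comm u v
    have h2 := o.areaForm_swap x u v
    apply Complex.ext <;> simp [hermitianProduct, h1, h2]
  add_right x u v w := by
    simp only [hermitianProduct_eq_smul_add_smul, inner_add_right]
    module
  smul_right x c u v := by
    have h1 : inner ℝ u (o.complexStructure x v) = -o.areaForm x u v := by
      rw [real_inner_comm, o.inner_complexStructure, o.areaForm_swap]
    simp only [hermitianProduct_eq_smul_add_smul, complexSMul, inner_add_right,
      real_inner_smul_right, o.inner_complexStructure_complexStructure, h1]
    rw [o.inner_complexStructure]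
    apply Complex.ext
    · simp
      ring
    · simp
  pos x v hv := by
    rw [hermitianProduct_eq_smul_add_smul]
    simpa only [Complex.add_re, Complex.smul_re, Complex.one_re, Complex.I_re, smul_eq_mul, mul_one,
      mul_zero, add_zero] using real_inner_self_pos.2 hv
  smooth_J X x hX := o.contMDiffAt_complexStructure (n := ⊤) hX
  smooth_h X Y x hX hY := by
    have h1 := contMDiffAt_inner (n := ⊤) hX hY
    have h2 := contMDiffAt_inner (n := ⊤) (o.contMDiffAt_complexStructure (n := ⊤) hX) hY
    simp only [hermitianProduct_eq_smul_add_smul]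
    exact (h1.smul contMDiffAt_const).add (h2.smul contMDiffAt_const)

theorem isHermitianConnection :
    IsHermitianConnection o.complexStructure o.hermitianProduct (leviCivita (𝓡 2) M) where
  commutes X x v hX := o.leviCivita_rotate hX v
  deriv_h X Y x v hX hY := by
    have hJX : MDifferentiableFieldAt (o.rotate X) x := o.mdifferentiableAt_complexStructure hX
    have h1 := mdifferentiableAt_inner (𝓡 2) hX hY
    have h2 := mdifferentiableAt_inner (𝓡 2) hJX hY
    have hc (c : ℂ) : MDifferentiableAt (𝓡 2) 𝓘(ℝ, ℂ) (fun _ : M ↦ c) x :=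
      mdifferentiableAt_const
    simp only [hermitianProduct_eq_smul_add_smul]
    have h := mvfderiv_add (h1.smul (hc 1)) (h2.smul (hc Complex.I))
    rw [mvfderiv_smul h1 (hc 1), mvfderiv_smul h2 (hc Complex.I), mvfderiv_const,
      mvfderiv_const] at h
    refine (DFunLike.congr_fun h v).trans ?_
    simp only [add_apply, ContinuousLinearMap.smulRight_apply, smul_zero, zero_add]
    rw [mvfderiv_inner_apply hX hY, mvfderiv_inner_apply hJX hY, o.leviCivita_rotate hX]
    module

/-- On a surface the curvature is determined by one smooth function `k`:
`R(X, Y)Z = -k ⋆1(X, Y) j Z`. -/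
theorem exists_curvature_eq (x : M) :
    ∃ (U : Set M) (k : M → ℝ), IsOpen U ∧ x ∈ U ∧ ∀ y ∈ U, ContMDiffAt (𝓡 2) 𝓘(ℝ) ∞ k y ∧
      ∀ X Y Z : Π y : M, TangentSpace (𝓡 2) y, ContMDiffFieldAt ∞ X y → ContMDiffFieldAt ∞ Y y →
        ContMDiffFieldAt ∞ Z y → curvature (leviCivita (𝓡 2) M) X Y Z y =
          -(k y * o.areaForm y (X y) (Y y)) • o.complexStructure y (Z y) := by
  obtain ⟨U, e, hx, he⟩ := o.exists_unit_field x
  refine ⟨U, dualExtDeriv (o.frameBracket e) e (o.rotate e), he.isOpen, hx, fun y hy ↦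
    ⟨o.contMDiffAt_dualExtDeriv_frame he hy, fun X Y Z hX hY hZ ↦ ?_⟩⟩
  rw [o.curvature_eq_dualExtDeriv he hy (hX.of_le (by norm_cast)) (hY.of_le (by norm_cast))
    (hZ.of_le (by norm_cast)), o.dualExtDeriv_eq_mul_areaForm he hy
    ((o.contMDiffAt_frameBracket he hy).mdifferentiableAt (by simp))
    (hX.mdifferentiableAt (by simp)) (hY.mdifferentiableAt (by simp))]

/-- By Lagrange's identity the denominator of the sectional curvature is `⋆1(u, v) ^ 2`, which
cancels against the numerator. -/
theorem sectionalCurvature_eq_of_curvatureTensor {x : M} {k : ℝ}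
    (h : ∀ u v w, curvatureTensor (leviCivita (𝓡 2) M) x u v w =
      -(k * o.areaForm x u v) • o.complexStructure x w)
    {u v : TangentSpace (𝓡 2) x} (huv : LinearIndependent ℝ ![u, v]) :
    sectionalCurvature x u v = k := by
  have h0 : o.areaForm x u v ≠ 0 := (o.orientation x).areaForm_ne_zero_of_linearIndependent huv
  have hd : inner ℝ u u * inner ℝ v v - inner ℝ u v ^ 2 = (o.areaForm x u v ^ 2 : ℝ) := by
    rw [← o.inner_sq_add_areaForm_sq]
    ring
  rw [sectionalCurvature, h, real_inner_smul_left, o.inner_complexStructure, hd,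
    o.areaForm_swap x v u]
  field_simp

theorem gaussianCurvature_eq_of_curvatureTensor {x : M} {k : ℝ}
    (h : ∀ u v w, curvatureTensor (leviCivita (𝓡 2) M) x u v w =
      -(k * o.areaForm x u v) • o.complexStructure x w) : gaussianCurvature x = k := by
  let b : Module.Basis (Fin 2) ℝ (TangentSpace (𝓡 2) x) :=
    Module.finBasisOfFinrankEq ℝ _ (fact_finrank_tangentSpace x).out
  refine o.sectionalCurvature_eq_of_curvatureTensor (u := b 0) (v := b 1) h ?_
  have hb : ![b 0, b 1] = ⇑b := funext fun i ↦ by fin_cases i <;> rfl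
  exact hb ▸ b.linearIndependent

/-- Near every point the Gauss curvature is the function of `exists_curvature_eq`. -/
theorem exists_gaussianCurvature_eq (x : M) :
    ∃ (U : Set M) (k : M → ℝ), IsOpen U ∧ x ∈ U ∧ ContMDiffAt (𝓡 2) 𝓘(ℝ) ∞ k x ∧
      (∀ y ∈ U, gaussianCurvature y = k y) ∧
      ∀ X Y Z : Π y : M, TangentSpace (𝓡 2) y, ContMDiffFieldAt ∞ X x → ContMDiffFieldAt ∞ Y x →
        ContMDiffFieldAt ∞ Z x → curvature (leviCivita (𝓡 2) M) X Y Z x =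
          -(k x * o.areaForm x (X x) (Y x)) • o.complexStructure x (Z x) := by
  obtain ⟨U, k, hU, hx, h⟩ := o.exists_curvature_eq x
  refine ⟨U, k, hU, hx, (h x hx).1, fun y hy ↦ ?_, (h x hx).2⟩
  refine o.gaussianCurvature_eq_of_curvatureTensor fun u v w ↦ ?_
  have := (h y hy).2 _ _ _ (contMDiffAt_extend (𝓡 2) (EuclideanSpace ℝ (Fin 2)) u)
    (contMDiffAt_extend (𝓡 2) (EuclideanSpace ℝ (Fin 2)) v)
    (contMDiffAt_extend (𝓡 2) (EuclideanSpace ℝ (Fin 2)) w)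
  rwa [extend_apply_self, extend_apply_self, extend_apply_self] at this

/-- The curvature of an oriented surface: `R(X, Y)Z = -K ⋆1(X, Y) j Z`. -/
theorem curvature_eq {x : M} {X Y Z : Π y : M, TangentSpace (𝓡 2) y}
    (hX : ContMDiffFieldAt ∞ X x) (hY : ContMDiffFieldAt ∞ Y x) (hZ : ContMDiffFieldAt ∞ Z x) :
    curvature (leviCivita (𝓡 2) M) X Y Z x =
      -(gaussianCurvature x * o.areaForm x (X x) (Y x)) • o.complexStructure x (Z x) := by
  obtain ⟨U, k, -, hx, -, hk, h⟩ := o.exists_gaussianCurvature_eq x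
  rw [h X Y Z hX hY hZ, hk x hx]

theorem curvatureTensor_eq (x : M) (u v w : TangentSpace (𝓡 2) x) :
    curvatureTensor (leviCivita (𝓡 2) M) x u v w =
      -(gaussianCurvature x * o.areaForm x u v) • o.complexStructure x w := by
  have := o.curvature_eq (contMDiffAt_extend (𝓡 2) (EuclideanSpace ℝ (Fin 2)) u)
    (contMDiffAt_extend (𝓡 2) (EuclideanSpace ℝ (Fin 2)) v)
    (contMDiffAt_extend (𝓡 2) (EuclideanSpace ℝ (Fin 2)) w)
  rwa [extend_apply_self, extend_apply_self, extend_apply_self] at this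

/-- The curvature form is `-√-1 K ⋆1`. -/
theorem curvatureForm_eq (x : M) (u v : TangentSpace (𝓡 2) x) :
    curvatureForm o.complexStructure (leviCivita (𝓡 2) M) x u v =
      ⟨0, -(gaussianCurvature x * o.areaForm x u v)⟩ := by
  have hw (w : TangentSpace (𝓡 2) x) : curvatureTensor (leviCivita (𝓡 2) M) x u v w =
      complexSMul (o.complexStructure x) ⟨0, -(gaussianCurvature x * o.areaForm x u v)⟩ w := by
    rw [o.curvatureTensor_eq]
    simp [complexSMul]
  have hc : ∃ c : ℂ, ∀ w, curvatureTensor (leviCivita (𝓡 2) M) x u v w =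
    complexSMul (o.complexStructure x) c w := ⟨_, hw⟩
  rw [curvatureForm, dif_pos hc]
  exact o.complexSMul_injective fun w ↦ (hc.choose_spec w).symm.trans (hw w)

theorem isCurvatureForm : IsCurvatureForm o.complexStructure (leviCivita (𝓡 2) M)
    (curvatureForm o.complexStructure (leviCivita (𝓡 2) M)) := by
  intro x X Y Z hX hY hZ
  rw [o.curvatureForm_eq, o.curvature_eq hX hY hZ]
  simp [complexSMul]

theorem contMDiff_gaussianCurvature (o : SurfaceOrientation M) :
    ContMDiff (𝓡 2) 𝓘(ℝ) ∞ (gaussianCurvature : M → ℝ) := by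
  intro x
  obtain ⟨U, k, hU, hx, hk, hK, -⟩ := o.exists_gaussianCurvature_eq x
  refine hk.congr_of_eventuallyEq ?_
  filter_upwards [hU.mem_nhds hx] with y hy using hK y hy

end SurfaceOrientation

end GaussCurvature

theorem mainTheorem2 {M : Type*} [TopologicalSpace M]
    [ChartedSpace (EuclideanSpace ℝ (Fin 2)) M] [IsManifold (𝓡 2) ∞ M]
    [RiemannianBundle (fun x : M ↦ TangentSpace (𝓡 2) x)]
    [IsContMDiffRiemannianBundle (𝓡 2) ∞ (EuclideanSpace ℝ (Fin 2))
      (fun x : M ↦ TangentSpace (𝓡 2) x)]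
    (o : SurfaceOrientation M) :
    IsHermitianLineBundle o.complexStructure o.hermitianProduct ∧
    IsHermitianConnection o.complexStructure o.hermitianProduct (leviCivita (𝓡 2) M) ∧
    IsCurvatureForm o.complexStructure (leviCivita (𝓡 2) M)
      (curvatureForm o.complexStructure (leviCivita (𝓡 2) M)) ∧
    (∀ (x : M) (u v : TangentSpace (𝓡 2) x), LinearIndependent ℝ ![u, v] →
      sectionalCurvature x u v = gaussianCurvature x) ∧
    ContMDiff (𝓡 2) 𝓘(ℝ) ∞ (gaussianCurvature : M → ℝ) ∧
    ∀ (x : M) (u v : TangentSpace (𝓡 2) x),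
      Complex.I * curvatureForm o.complexStructure (leviCivita (𝓡 2) M) x u v =
        ((gaussianCurvature x * o.areaForm x u v : ℝ) : ℂ) := by
  refine ⟨o.isHermitianLineBundle, o.isHermitianConnection, o.isCurvatureForm,
    fun x u v huv ↦ o.sectionalCurvature_eq_of_curvatureTensor (o.curvatureTensor_eq x) huv,
    o.contMDiff_gaussianCurvature, fun x u v ↦ ?_⟩
  rw [o.curvatureForm_eq]
  apply Complex.ext <;> simp
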